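/- Let $C_0, C_1, C_2, \dots$ be the polynomials defined by $C_0(X) = 0$ and, for $n \ge 0$, $$C_{n+1}(X) = \frac{n+1}{n+2}\left((X^2+1)X^n + \sum_{k=0}^{n} \lambda_n^k\, C_k(X)\right),$$ where $\lambda_n^k$ denotes the coefficient of $X^k$ in $C_n(X)$. (These are the polynomials $C_n$ for which, with suitable polynomials $A_n$ vanishing at $0$, $ab^n = A_n(a) + C_n(b)$ holds for all elements $a, b$ of a complex algebra with $2ab = a^2+b^2+1$.) Then for every integer $n \ge 0$ and every real $z$ the integral below converges absolutely (the singularity of the integrand at $t = e^z$ is removable) and $$(e^z+1)\int_0^{\infty} \frac{\ln^n(t) - z^n}{(1+t)(t-e^z)}\,dt = \pi^{n+1}\, C_n\!\left(\frac{z}{\pi}\right).$$ Moreover, as a special case, for every integer $n \ge 1$ the integral below converges absolutely and $$4\int_0^1 \frac{\ln^{2n-1}(x)}{x^2-1}\,dx = \frac{(4^n-1)(-1)^{n-1}\beta_{2n}}{n}\,\pi^{2n},$$ where $\beta_{m} = B_{m}(0)$ is the $m$-th Bernoulli number. -/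

import Mathlib

open scoped Polynomial

/-- The polynomials `C_n`, defined by `C_0 = 0` and, with `λ_n^k` the coefficient of `X ^ k` in
`C_n`,
`C_{n+1} = (n+1)/(n+2) * ((X ^ 2 + 1) * X ^ n + ∑_{k=0}^{n} λ_n^k C_k)`.
All coefficients are rational. -/
noncomputable def quadraticC : ℕ → ℚ[X]
  | 0 => 0
  | n + 1 => Polynomial.C (((n : ℚ) + 1) / ((n : ℚ) + 2)) *
      ((Polynomial.X ^ 2 + 1) * Polynomial.X ^ n +
        ∑ k : Fin (n + 1),
          Polynomial.C ((quadraticC n).coeff (k : ℕ)) * quadraticC (k : ℕ))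
decreasing_by all_goals omega

/-! Both sides are reduced to the same expression in Bernoulli numbers. On the algebraic side, `L =
quadraticLift` satisfies `2 L X = X² + 1 + L²` as operators. Taking the commutator with `D = d/dX`
shows that `[D, L] - 1` sends each `X ^ n` to a constant, so `C_{n+1}' = (n+1) C_n + X^{n+1} + c`.
As every `C_n` vanishes at `±i`, this recursion has only one solution, a Bernoulli polynomial in `x
/ (2i)` plus explicit terms (`closed_form`).

On the analytic side, `t = e^s` produces two exponential fractions. Each is a step function up to an
odd, exponentially decaying kernel; the kernels contribute Bose–Einstein and Fermi–Dirac moments,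
that is, even zeta values, and the steps an integral between `z` and `0`. The second formula uses
the same moments directly, through `x = e^{-u}`. -/

open Polynomial in
/-- The linear map sending `X ^ k` to `C_k`. -/
noncomputable def quadraticLift : ℚ[X] →ₗ[ℚ] ℚ[X] :=
  Polynomial.lsum fun k => (LinearMap.toSpanSingleton ℚ ℚ[X] (quadraticC k))

/-! ### Operator relation and derivative of `C_n` -/

namespace quadraticC

open Polynomial

theorem lift_X_pow (k : ℕ) : quadraticLift (X ^ k) = quadraticC k := by
  rw [quadraticLift, lsum_apply, X_pow_eq_monomial, sum_monomial_index] <;> simp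

theorem lift_eq_sum {p : ℚ[X]} {n : ℕ} (hp : p.natDegree < n) :
    quadraticLift p = ∑ k ∈ Finset.range n, p.coeff k • quadraticC k := by
  rw [quadraticLift, lsum_apply, sum_over_range' p _ n hp] <;> simp

theorem zero_eq : quadraticC 0 = 0 := by rw [quadraticC]

theorem succ_eq (n : ℕ) : quadraticC (n + 1) = (((n : ℚ) + 1) / ((n : ℚ) + 2)) •
    ((X ^ 2 + 1) * X ^ n +
      ∑ k ∈ Finset.range (n + 1), (quadraticC n).coeff k • quadraticC k) := by
  rw [quadraticC, ← Finset.sum_range fun k => C ((quadraticC n).coeff k) * quadraticC k]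
  simp only [smul_eq_C_mul]

theorem natDegree_le (n : ℕ) : (quadraticC n).natDegree ≤ n + 1 := by
  induction n using Nat.strong_induction_on with
  | _ n ih =>
    rcases n with _ | n
    · simp [zero_eq]
    · rw [succ_eq]
      refine (natDegree_smul_le _ _).trans (natDegree_add_le_of_degree_le ?_ ?_)
      · have : (X ^ 2 + 1 : ℚ[X]).natDegree = 2 := by compute_degree!
        refine natDegree_mul_le.trans ?_
        rw [this, natDegree_X_pow]; omega
      · refine natDegree_sum_le_of_forall_le _ _ fun k hk => ?_
        have hk := Finset.mem_range.1 hk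
        exact (natDegree_smul_le _ _).trans ((ih k hk).trans (by omega))

theorem coeff_succ_self (n : ℕ) : (quadraticC n).coeff (n + 1) = n / (n + 1) := by
  rcases n with _ | n
  · simp [zero_eq]
  · rw [succ_eq, coeff_smul, coeff_add, finsetSum_coeff, Finset.sum_eq_zero]
    · have : (X ^ 2 + 1 : ℚ[X]) * X ^ n = X ^ (n + 2) + X ^ n := by ring
      rw [this, coeff_add, coeff_X_pow, coeff_X_pow]
      simp only [↓reduceIte, show n + 1 + 1 ≠ n by omega, smul_eq_mul]
      push_cast
      ring
    · intro k hk
      have hk := Finset.mem_range.1 hk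
      rw [coeff_smul, coeff_eq_zero_of_natDegree_lt (p := quadraticC k)
        ((natDegree_le k).trans_lt (by omega)), smul_zero]

theorem lift_eq (n : ℕ) : quadraticLift (quadraticC n) =
    (∑ k ∈ Finset.range (n + 1), (quadraticC n).coeff k • quadraticC k) +
      ((n : ℚ) / (n + 1)) • quadraticC (n + 1) := by
  rw [lift_eq_sum (Nat.lt_succ_of_le (natDegree_le n)), Finset.sum_range_succ, coeff_succ_self]

/-- The leading term of `C_n` adds `n/(n+1) C_{n+1}` to the sum in the recursion, and `(n+2)/(n+1) +
n/(n+1) = 2`. -/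
theorem two_smul_lift_X_pow_succ (n : ℕ) : (2 : ℚ) • quadraticLift (X ^ (n + 1)) =
    (X ^ 2 + 1) * X ^ n + quadraticLift (quadraticLift (X ^ n)) := by
  rw [lift_X_pow, lift_X_pow, lift_eq]
  have h := congrArg (fun p => (((n : ℚ) + 2) / ((n : ℚ) + 1)) • p) (succ_eq n)
  have h1 : ((n : ℚ) + 2) / ((n : ℚ) + 1) * (((n : ℚ) + 1) / ((n : ℚ) + 2)) = 1 := by
    field_simp
  simp only [smul_smul, h1, one_smul] at h
  rw [← add_assoc, ← h, ← add_smul]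
  congr 1
  field_simp
  ring

/-- The relation `2ab = a² + b² + 1`, with `quadraticLift` in the role of `a` and
multiplication by `X` in the role of `b`. -/
theorem two_smul_lift_X_mul (f : ℚ[X]) : (2 : ℚ) • quadraticLift (X * f) =
    (X ^ 2 + 1) * f + quadraticLift (quadraticLift f) := by
  induction f using Polynomial.induction_on' with
  | add p q hp hq => simp only [mul_add, map_add, smul_add, hp, hq]; ring
  | monomial n a =>
    rw [← smul_X_eq_monomial, mul_smul_comm, ← pow_succ', map_smul, smul_comm,
      two_smul_lift_X_pow_succ]
    simp only [map_smul, mul_smul_comm, smul_add]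

/-- The defect of the commutation relation `[d/dX, L] = 1`, for `L = quadraticLift`. -/
noncomputable def commDefect : ℚ[X] →ₗ[ℚ] ℚ[X] :=
  derivative ∘ₗ quadraticLift - quadraticLift ∘ₗ derivative - LinearMap.id

theorem commDefect_apply (f : ℚ[X]) :
    commDefect f = derivative (quadraticLift f) - quadraticLift (derivative f) - f := rfl

theorem two_smul_commDefect_X_mul (f : ℚ[X]) : (2 : ℚ) • commDefect (X * f) =
    commDefect (quadraticLift f) + quadraticLift (commDefect f) := by
  have h1 := congrArg derivative (two_smul_lift_X_mul f)
  have h2 := two_smul_lift_X_mul (derivative f)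
  simp only [derivative_smul, derivative_add, derivative_mul, derivative_X_pow, derivative_one]
    at h1
  simp only [commDefect_apply, smul_sub, h1, derivative_mul, derivative_X, map_add, map_sub,
    smul_add, h2, one_mul]
  simp only [smul_eq_C_mul, Nat.cast_ofNat, map_ofNat]
  simp
  ring

/-- Write `E` for `commDefect`. Inductively `E (X ^ n)` is constant, hence killed by `L` since `C_0
= 0`. So `2 E (X ^ (n+1)) = E C_n`, which modulo constants is `n/(n+1) E (X ^ (n+1))`, and `2 ≠
n/(n+1)`. -/
theorem derivative_commDefect_X_pow (n : ℕ) : derivative (commDefect (X ^ n)) = 0 := by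
  induction n using Nat.strong_induction_on with
  | _ n ih =>
    rcases n with _ | n
    · rw [commDefect_apply, lift_X_pow, zero_eq, pow_zero]
      simp
    · have h := congrArg derivative (two_smul_commDefect_X_mul (X ^ n))
      have hc : quadraticLift (commDefect (X ^ n)) = 0 := by
        rw [eq_C_of_derivative_eq_zero (ih n n.lt_succ_self), ← mul_one (C _), ← smul_eq_C_mul,
          ← pow_zero X, map_smul, lift_X_pow, zero_eq, smul_zero]
      have hs : quadraticC n = (∑ k ∈ Finset.range (n + 1), (quadraticC n).coeff k • X ^ k) +
          ((n : ℚ) / (n + 1)) • X ^ (n + 1) := by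
        conv_lhs => rw [(quadraticC n).as_sum_range' (n + 2) (by have := natDegree_le n; omega),
          Finset.sum_range_succ, coeff_succ_self]
        simp only [smul_X_eq_monomial]
      rw [← pow_succ', hc, add_zero, lift_X_pow, hs, map_add, map_sum, derivative_add,
        derivative_sum, Finset.sum_eq_zero, zero_add, map_smul, map_smul, map_smul,
        ← sub_eq_zero, ← sub_smul] at h
      · refine (smul_eq_zero.1 h).resolve_left ?_
        have : (2 : ℚ) - n / (n + 1) = (n + 2) / (n + 1) := by field_simp; ring
        rw [this]; positivity
      · intro k hk
        rw [map_smul, derivative_smul, ih k (by simpa using hk), smul_zero]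

theorem exists_derivative_eq (n : ℕ) : ∃ c : ℚ, derivative (quadraticC (n + 1)) =
    ((n : ℚ) + 1) • quadraticC n + X ^ (n + 1) + C c := by
  have h := eq_C_of_derivative_eq_zero (derivative_commDefect_X_pow (n + 1))
  refine ⟨(commDefect (X ^ (n + 1))).coeff 0, ?_⟩
  rw [← h, commDefect_apply, lift_X_pow, derivative_X_pow, ← smul_eq_C_mul, map_smul,
    Nat.add_sub_cancel, lift_X_pow]
  push_cast
  ring

theorem X_sq_add_one_dvd (n : ℕ) : X ^ 2 + 1 ∣ quadraticC n := by
  induction n using Nat.strong_induction_on with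
  | _ n ih =>
    rcases n with _ | n
    · simp [zero_eq]
    · rw [succ_eq]
      refine dvd_smul_of_dvd _ (dvd_add (dvd_mul_right _ _) (Finset.dvd_sum fun k hk => ?_))
      exact dvd_smul_of_dvd _ (ih k (Finset.mem_range.1 hk))

theorem aeval_eq_zero {n : ℕ} {x : ℂ} (hx : x ^ 2 + 1 = 0) : aeval x (quadraticC n) = 0 := by
  obtain ⟨q, hq⟩ := X_sq_add_one_dvd n
  rw [hq, map_mul]
  simp [hx]

end quadraticC

/-! ### Closed form of `C_n` by Bernoulli polynomials -/

theorem Polynomial.bernoulli_eval_half (k : ℕ) :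
    (Polynomial.bernoulli k).eval (1 / 2) = (2 / 2 ^ k - 1) * _root_.bernoulli k := by
  have h := bernoulliFun_eval_half k
  have h2 : (2⁻¹ : ℝ) = algebraMap ℚ ℝ (1 / 2) := by norm_num
  rw [bernoulliFun, h2, Polynomial.eval_map_apply, eq_ratCast] at h
  apply Rat.cast_injective (α := ℝ)
  push_cast
  exact h

theorem Polynomial.bernoulli_eval_neg_half (k : ℕ) :
    (Polynomial.bernoulli k).eval (-(1 / 2)) =
      (Polynomial.bernoulli k).eval (1 / 2) - k * (-(1 / 2)) ^ (k - 1) := by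
  rw [eq_sub_iff_add_eq, ← Polynomial.bernoulli_eval_one_add]
  norm_num

namespace quadraticC

open Polynomial Complex

theorem aeval_ratCast (p : ℚ[X]) (q : ℚ) : aeval (q : ℂ) p = (p.eval q : ℚ) := by
  have := aeval_algebraMap_apply ℂ q p
  simpa using this

/-- An affine function with two zeros vanishes; the unknown constant in the derivative of `C_{n+1}`
therefore never has to be computed. -/
theorem eq_zero_of_hasDerivAt_const {f : ℂ → ℂ} {c : ℂ} (hf : ∀ x, HasDerivAt f c x)
    (h1 : f I = 0) (h2 : f (-I) = 0) (x : ℂ) : f x = 0 := by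
  have hd : ∀ x, HasDerivAt (fun x => f x - c * x) 0 x := fun x => by
    simpa using! (hf x).sub ((hasDerivAt_id x).const_mul c)
  have hc := is_const_of_deriv_eq_zero (fun x => (hd x).differentiableAt) (fun x => (hd x).deriv)
  have e1 := hc I (-I)
  have e2 := hc x I
  simp only [h1, h2] at e1 e2
  have hc0 : c = 0 := by
    have : c * (2 * I) = 0 := by linear_combination -e1
    simpa using this
  subst hc0
  simpa using e2

/-- The difference between the two sides of the closed form of `(n + 1) * C_n`. -/
noncomputable def closedFormDefect (n : ℕ) (x : ℂ) : ℂ :=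
  (n + 1) * aeval x (quadraticC n) - ((n + 1) * x ^ (n + 1) - (n + 1) * I * x ^ n
    - (2 * I) ^ (n + 1) * aeval (x / (2 * I)) (Polynomial.bernoulli (n + 1))
    + (2 * I) ^ (n + 1) * ((Polynomial.bernoulli (n + 1)).eval (1 / 2) : ℚ))

theorem closedFormDefect_I (n : ℕ) : closedFormDefect n I = 0 := by
  have h : I / (2 * I) = ((1 / 2 : ℚ) : ℂ) := by
    push_cast; field_simp
  rw [closedFormDefect, aeval_eq_zero (by simp), h, aeval_ratCast]
  ring

theorem closedFormDefect_neg_I (n : ℕ) : closedFormDefect n (-I) = 0 := by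
  have h : -I / (2 * I) = ((-(1 / 2) : ℚ) : ℂ) := by
    push_cast; field_simp
  have h2 : (2 * I) ^ (n + 1) * (-(1 / 2)) ^ n = 2 * I * (-I) ^ n := by
    rw [pow_succ', mul_assoc, ← mul_pow]
    ring_nf
  rw [closedFormDefect, aeval_eq_zero (by simp), h, aeval_ratCast,
    Polynomial.bernoulli_eval_neg_half]
  push_cast
  linear_combination (-(n : ℂ) - 1) * h2

theorem hasDerivAt_closedFormDefect_succ (n : ℕ) : ∃ c : ℂ, ∀ x,
    HasDerivAt (closedFormDefect (n + 1)) ((n + 2) * closedFormDefect n x + c) x := by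
  obtain ⟨c, hc⟩ := exists_derivative_eq n
  refine ⟨(n + 2) * (c + (2 * I) ^ (n + 1) *
    ((Polynomial.bernoulli (n + 1)).eval (1 / 2) : ℚ)), fun x => ?_⟩
  have hC := (quadraticC (n + 1)).hasDerivAt_aeval x
  have hB := ((Polynomial.bernoulli (n + 2)).hasDerivAt_aeval (x / (2 * I))).comp x
    ((hasDerivAt_id x).div_const (2 * I))
  rw [hc] at hC
  rw [Polynomial.derivative_bernoulli] at hB
  have := (hC.const_mul ((n : ℂ) + 2)).sub
    (((((hasDerivAt_pow (n + 2) x).const_mul ((n : ℂ) + 2)).sub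
      ((hasDerivAt_pow (n + 1) x).const_mul (((n : ℂ) + 2) * I))).sub
      (hB.const_mul ((2 * I) ^ (n + 2)))).add_const
      ((2 * I) ^ (n + 2) * ((Polynomial.bernoulli (n + 2)).eval (1 / 2) : ℚ)))
  convert! this using 1
  · ext y
    simp only [closedFormDefect, Pi.sub_apply, Function.comp_apply, id]
    push_cast
    ring_nf
  · simp only [closedFormDefect, map_add, map_one, map_mul, map_pow, aeval_X, aeval_C,
      eq_ratCast, map_natCast, Nat.add_sub_cancel, show n + 2 - 1 = n + 1 by omega,
      Algebra.smul_def]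
    have h2 : (2 * I) ^ (n + 2) * (1 / (2 * I)) = (2 * I) ^ (n + 1) := by
      rw [pow_succ _ (n + 1)]; field_simp
    push_cast
    linear_combination (-((n : ℂ) + 2)) *
      aeval (x / (2 * I)) (Polynomial.bernoulli (n + 1)) * h2

theorem closedFormDefect_eq_zero (n : ℕ) (x : ℂ) : closedFormDefect n x = 0 := by
  induction n generalizing x with
  | zero =>
    have h : (2 : ℂ) * I ≠ 0 := by simp
    simp [closedFormDefect, zero_eq, Polynomial.bernoulli_one]
    field_simp
    ring
  | succ n ih =>
    obtain ⟨c, hc⟩ := hasDerivAt_closedFormDefect_succ n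
    simp only [ih, mul_zero, zero_add] at hc
    exact eq_zero_of_hasDerivAt_const hc (closedFormDefect_I _) (closedFormDefect_neg_I _) x

/-- An expression of `C_n` in terms of Bernoulli numbers. -/
theorem closed_form (n : ℕ) (x : ℂ) : (n + 1) * aeval x (quadraticC n) =
    n * x ^ (n + 1) - ∑ k ∈ Finset.Icc 1 n,
      (n + 1).choose (k + 1) * (2 * I) ^ (k + 1) * (_root_.bernoulli (k + 1) : ℚ) * x ^ (n - k)
    - (2 * I) ^ (n + 1) * (1 - 1 / 2 ^ n) * (_root_.bernoulli (n + 1) : ℚ) := by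
  have h := closedFormDefect_eq_zero n x
  have hB : (2 * I) ^ (n + 1) * aeval (x / (2 * I)) (Polynomial.bernoulli (n + 1)) =
      ∑ k ∈ Finset.range (n + 2),
        (n + 1).choose k * (2 * I) ^ k * (_root_.bernoulli k : ℚ) * x ^ (n + 1 - k) := by
    rw [Polynomial.bernoulli, map_sum, Finset.mul_sum]
    refine Finset.sum_congr rfl fun k hk => ?_
    have hk : k ≤ n + 1 := by have := Finset.mem_range.1 hk; omega
    rw [aeval_monomial, div_pow, ← pow_sub_mul_pow (2 * I) hk]
    have : (2 * I) ^ (n + 1 - k) ≠ 0 := by simp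
    push_cast [eq_ratCast]
    field_simp
  -- The terms of index 0 and 1 are split off: the first turns `(n+1) x^{n+1}` into `n x^{n+1}`, the
  -- second cancels `(n+1) i x^n`.
  rw [Finset.sum_range_succ', Finset.sum_range_succ'] at hB
  have hS : ∑ k ∈ Finset.Icc 1 n, ((n + 1).choose (k + 1) : ℂ) * (2 * I) ^ (k + 1) *
      (_root_.bernoulli (k + 1) : ℚ) * x ^ (n - k) = ∑ k ∈ Finset.range n,
      ((n + 1).choose (k + 1 + 1) : ℂ) * (2 * I) ^ (k + 1 + 1) *
      (_root_.bernoulli (k + 1 + 1) : ℚ) * x ^ (n - (k + 1)) := by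
    rw [← Finset.Ico_succ_right_eq_Icc, Finset.sum_Ico_eq_sum_range]
    refine Finset.sum_congr (by simp) fun k _ => ?_
    rw [add_comm 1 k]
  rw [closedFormDefect, hB, Polynomial.bernoulli_eval_half] at h
  rw [hS]
  simp only [zero_add, pow_one, Nat.choose_one_right, Nat.choose_zero_right, pow_zero,
    _root_.bernoulli_one, _root_.bernoulli_zero, Nat.add_sub_cancel, Nat.sub_zero,
    Nat.add_sub_add_right] at h
  push_cast at h
  rw [pow_succ (2 : ℂ) n] at h
  linear_combination h

end quadraticC

/-! ### Bose–Einstein and Fermi–Dirac moments -/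

section Moments

open Set MeasureTheory Real

theorem integral_pow_mul_exp_neg_mul_Ioi (k : ℕ) {r : ℝ} (hr : 0 < r) :
    ∫ x in Ioi (0 : ℝ), x ^ k * rexp (-(r * x)) = k.factorial / r ^ (k + 1) := by
  have h := integral_rpow_mul_exp_neg_mul_Ioi (a := (k : ℝ) + 1) (by positivity) hr
  rw [Gamma_nat_eq_factorial, add_sub_cancel_right] at h
  simp only [rpow_natCast] at h
  rw [h, ← Nat.cast_add_one, rpow_natCast, one_div, inv_pow, div_eq_inv_mul]

theorem integrableOn_pow_mul_exp_neg_mul_Ioi (k : ℕ) {r : ℝ} (hr : 0 < r) :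
    IntegrableOn (fun x : ℝ => x ^ k * rexp (-(r * x))) (Ioi 0) :=
  -- A non-integrable function has integral 0 by convention.
  .of_integral_ne_zero (by rw [integral_pow_mul_exp_neg_mul_Ioi k hr]; positivity)

theorem hasSum_exp_neg_succ_mul {x : ℝ} (hx : 0 < x) :
    HasSum (fun n : ℕ => rexp (-(((n : ℝ) + 1) * x))) (1 / (rexp x - 1)) := by
  have h1 : rexp (-x) < 1 := by simpa using hx
  have h := (hasSum_geometric_of_lt_one (exp_pos (-x)).le h1).mul_left (rexp (-x))
  convert! h using 1
  · ext n
    rw [← exp_nat_mul, ← exp_add]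
    congr 1; ring
  · have : rexp x - 1 ≠ 0 := (sub_pos.2 (one_lt_exp_iff.2 hx)).ne'
    rw [exp_neg] at h1 ⊢
    have h2 : 1 - (rexp x)⁻¹ ≠ 0 := (sub_pos.2 h1).ne'
    field_simp

/-- The moments of the Bose–Einstein distribution. -/
theorem hasSum_integral_pow_div_exp_sub_one {k : ℕ} (hk : k ≠ 0) :
    HasSum (fun n : ℕ => (k.factorial : ℝ) / ((n : ℝ) + 1) ^ (k + 1))
      (∫ x in Ioi (0 : ℝ), x ^ k / (rexp x - 1)) := by
  have hr (n : ℕ) : (0 : ℝ) < (n : ℝ) + 1 := by positivity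
  have hs : Summable fun n : ℕ => (k.factorial : ℝ) / ((n : ℝ) + 1) ^ (k + 1) := by
    have h := (Real.summable_one_div_nat_pow (p := k + 1)).2 (by omega)
    have h := ((summable_nat_add_iff 1).2 h).mul_left (k.factorial : ℝ)
    simpa [div_eq_mul_inv] using h
  have h := hasSum_integral_of_summable_integral_norm (μ := volume.restrict (Ioi (0 : ℝ)))
    (F := fun (n : ℕ) (x : ℝ) => x ^ k * rexp (-(((n : ℝ) + 1) * x)))
    (fun n => integrableOn_pow_mul_exp_neg_mul_Ioi k (hr n)) ?_
  · simp only [integral_pow_mul_exp_neg_mul_Ioi k (hr _)] at h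
    convert! h using 1
    refine setIntegral_congr_fun measurableSet_Ioi fun x hx => ?_
    simp only [tsum_mul_left, (hasSum_exp_neg_succ_mul hx).tsum_eq, mul_one_div]
  · refine hs.congr fun n => ?_
    rw [← integral_pow_mul_exp_neg_mul_Ioi k (hr n)]
    refine setIntegral_congr_fun measurableSet_Ioi fun x hx => ?_
    have hx : (0 : ℝ) < x := hx
    exact (Real.norm_of_nonneg (by positivity)).symm

theorem integrableOn_pow_div_exp_sub_one {k : ℕ} (hk : k ≠ 0) :
    IntegrableOn (fun x : ℝ => x ^ k / (rexp x - 1)) (Ioi 0) := by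
  have h := hasSum_integral_pow_div_exp_sub_one hk
  refine .of_integral_ne_zero (ne_of_gt ?_)
  refine lt_of_lt_of_le ?_ (le_hasSum h 0 fun n _ => by positivity)
  positivity

theorem pow_div_exp_add_one_eq (k : ℕ) {x : ℝ} (hx : 0 < x) : x ^ k / (rexp x + 1) =
    x ^ k / (rexp x - 1) - 2 / 2 ^ k * ((2 * x) ^ k / (rexp (2 * x) - 1)) := by
  have h1 : rexp x - 1 ≠ 0 := (sub_pos.2 (one_lt_exp_iff.2 hx)).ne'
  have h2 : rexp x + 1 ≠ 0 := by positivity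
  have h3 : rexp (2 * x) - 1 = (rexp x - 1) * (rexp x + 1) := by
    rw [two_mul, exp_add]; ring
  rw [h3, mul_pow]
  field_simp
  ring

theorem integral_pow_div_exp_add_one {k : ℕ} (hk : k ≠ 0) :
    ∫ x in Ioi (0 : ℝ), x ^ k / (rexp x + 1) =
      (1 - 1 / 2 ^ k) * ∫ x in Ioi (0 : ℝ), x ^ k / (rexp x - 1) := by
  have hi := integrableOn_pow_div_exp_sub_one hk
  have h2 := (integrableOn_Ioi_comp_mul_left_iff (fun x : ℝ => x ^ k / (rexp x - 1)) 0
    (two_pos)).2 (by simpa using hi)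
  rw [setIntegral_congr_fun measurableSet_Ioi fun x hx => pow_div_exp_add_one_eq k hx,
    integral_sub hi (h2.const_mul _), integral_const_mul,
    integral_comp_mul_left_Ioi (fun x : ℝ => x ^ k / (rexp x - 1)) 0 two_pos, mul_zero,
    smul_eq_mul]
  ring

theorem integrableOn_pow_div_exp_add_one (k : ℕ) :
    IntegrableOn (fun x : ℝ => x ^ k / (rexp x + 1)) (Ioi 0) := by
  refine (integrableOn_pow_mul_exp_neg_mul_Ioi k one_pos).mono' ?_ ?_
  · exact (Measurable.aestronglyMeasurable (by fun_prop))
  · filter_upwards [ae_restrict_mem measurableSet_Ioi] with x hx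
    have hx : (0 : ℝ) < x := hx
    rw [Real.norm_of_nonneg (by positivity), one_mul, exp_neg, div_eq_mul_inv]
    gcongr
    linarith

theorem integrable_and_integral_eq_of_Ioi {f : ℝ → ℝ} (h1 : IntegrableOn f (Ioi 0))
    (h2 : IntegrableOn (fun x => f (-x)) (Ioi 0)) :
    Integrable f ∧ ∫ x, f x = (∫ x in Ioi 0, f x) + ∫ x in Ioi 0, f (-x) := by
  have h3 : IntegrableOn f (Iic 0) := by
    rw [integrableOn_Iic_iff_integrableOn_Iio]
    have h := IntegrableOn.comp_neg_Iio (c := (0 : ℝ)) (f := fun x => f (-x)) (by simpa using h2)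
    exact h.congr_fun (fun x _ => congrArg f (neg_neg x)) measurableSet_Iio
  refine ⟨?_, ?_⟩
  · rw [← integrableOn_univ, ← Iic_union_Ioi (a := (0 : ℝ))]
    exact h3.union h1
  · rw [← intervalIntegral.integral_Iic_add_Ioi h3 h1, integral_comp_neg_Ioi, neg_zero, add_comm]

/-- Moments of an odd function, given by `φ` on the positive half-line. -/
theorem integrable_and_integral_pow_mul_of_odd {f φ : ℝ → ℝ} {k : ℕ}
    (hf : ∀ x, 0 < x → f x = φ x) (hf' : ∀ x, 0 < x → f (-x) = -φ x)
    (hφ : IntegrableOn (fun x => x ^ k * φ x) (Ioi 0)) :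
    Integrable (fun x => x ^ k * f x) ∧
      ∫ x, x ^ k * f x = (1 - (-1) ^ k) * ∫ x in Ioi 0, x ^ k * φ x := by
  have e1 : EqOn (fun x => x ^ k * φ x) (fun x => x ^ k * f x) (Ioi 0) := fun x hx => by
    simp only [hf x hx]
  have e2 : EqOn (fun x => (-(-1) ^ k) * (x ^ k * φ x)) (fun x => (-x) ^ k * f (-x)) (Ioi 0) :=
    fun x hx => by
      simp only [hf' x hx]
      rw [neg_pow x]
      ring
  obtain ⟨h1, h2⟩ := integrable_and_integral_eq_of_Ioi (f := fun x => x ^ k * f x)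
    (hφ.congr_fun e1 measurableSet_Ioi)
    (IntegrableOn.congr_fun (hφ.const_mul _) e2 measurableSet_Ioi)
  refine ⟨h1, ?_⟩
  rw [h2, ← setIntegral_congr_fun measurableSet_Ioi e1,
    ← setIntegral_congr_fun measurableSet_Ioi e2, integral_const_mul]
  ring

theorem integrable_and_integral_mul_step {f : ℝ → ℝ} (hf : Continuous f) (a b : ℝ) :
    Integrable (fun x => f x * ((if a < x then 1 else 0) - if b < x then 1 else 0)) ∧
      ∫ x, f x * ((if a < x then 1 else 0) - if b < x then 1 else 0) = ∫ x in a..b, f x := by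
  wlog hab : a ≤ b generalizing a b
  · obtain ⟨h1, h2⟩ := this b a (le_of_not_ge hab)
    have e : (fun x => f x * ((if a < x then 1 else 0) - if b < x then 1 else 0)) =
        fun x => -(f x * ((if b < x then 1 else 0) - if a < x then 1 else 0)) := by
      ext x; ring
    rw [e, intervalIntegral.integral_symm, integral_neg, h2]
    exact ⟨h1.neg, rfl⟩
  have e : (fun x => f x * ((if a < x then 1 else 0) - if b < x then 1 else 0)) =
      (Ioc a b).indicator f := by
    ext x
    simp only [indicator, mem_Ioc]
    split_ifs <;> grind
  rw [e, integral_indicator measurableSet_Ioc, intervalIntegral.integral_of_le hab]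
  exact ⟨(hf.integrableOn_Ioc).integrable_indicator measurableSet_Ioc, rfl⟩

/-- The odd function `sign u / (exp |u| - 1)`. -/
noncomputable def boseKernel (u : ℝ) : ℝ := 1 / (1 - rexp (-u)) - if 0 < u then 1 else 0

/-- The odd function `sign u / (exp |u| + 1)`. -/
noncomputable def fermiKernel (u : ℝ) : ℝ := (if 0 < u then 1 else 0) - 1 / (1 + rexp (-u))

/-- The moments of `boseKernel`. -/
noncomputable def boseMoment (k : ℕ) : ℝ :=
  (1 - (-1) ^ k) * ∫ x in Ioi (0 : ℝ), x ^ k / (rexp x - 1)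

theorem boseKernel_moment {k : ℕ} (hk : k ≠ 0) : Integrable (fun u => u ^ k * boseKernel u) ∧
    ∫ u, u ^ k * boseKernel u = boseMoment k := by
  have h := integrable_and_integral_pow_mul_of_odd (f := boseKernel)
    (φ := fun x => 1 / (rexp x - 1)) (k := k) ?_ ?_ ?_
  · simpa only [mul_one_div, boseMoment] using h
  · intro x hx
    have h1 : rexp x - 1 ≠ 0 := (sub_pos.2 (one_lt_exp_iff.2 hx)).ne'
    have h2 : 1 - (rexp x)⁻¹ ≠ 0 := by
      rw [← exp_neg]; exact (sub_pos.2 (Real.exp_lt_one_iff.2 (by linarith))).ne'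
    rw [boseKernel, if_pos hx, exp_neg]
    field_simp
    ring
  · intro x hx
    rw [boseKernel, if_neg (by linarith), neg_neg, sub_zero, ← neg_sub (rexp x), div_neg]
  · simpa only [mul_one_div] using integrableOn_pow_div_exp_sub_one hk

theorem fermiKernel_moment (k : ℕ) : Integrable (fun u => u ^ k * fermiKernel u) ∧
    ∫ u, u ^ k * fermiKernel u = (1 - 1 / 2 ^ k) * boseMoment k := by
  have h := integrable_and_integral_pow_mul_of_odd (f := fermiKernel)
    (φ := fun x => 1 / (rexp x + 1)) (k := k) ?_ ?_ ?_
  · refine ⟨h.1, h.2.trans ?_⟩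
    rcases eq_or_ne k 0 with rfl | hk
    · simp
    · simp only [mul_one_div, integral_pow_div_exp_add_one hk, boseMoment]
      ring
  · intro x hx
    rw [fermiKernel, if_pos hx, exp_neg]
    field_simp
    ring
  · intro x hx
    rw [fermiKernel, if_neg (by linarith), neg_neg, zero_sub, add_comm]
  · simpa only [mul_one_div] using integrableOn_pow_div_exp_add_one k

theorem integral_pow_div_exp_sub_one_eq {m : ℕ} (hm : m ≠ 0) :
    ∫ x in Ioi (0 : ℝ), x ^ (2 * m - 1) / (rexp x - 1) =
      (-1) ^ (m + 1) * (2 * π) ^ (2 * m) * (bernoulli (2 * m) : ℝ) / (4 * m) := by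
  have h := hasSum_integral_pow_div_exp_sub_one (k := 2 * m - 1) (by omega)
  have h2 := hasSum_zeta_nat hm
  -- The zeta series starts at index 0, where its term is `1 / 0 = 0`.
  rw [← hasSum_nat_add_iff' 1] at h2
  have h2 := h2.mul_left ((2 * m - 1).factorial : ℝ)
  have h3 : 2 * m - 1 + 1 = 2 * m := by omega
  rw [h3] at h
  rw [h.unique (by simpa [div_eq_mul_inv] using h2)]
  have h4 : ((2 * m).factorial : ℝ) = 2 * m * (2 * m - 1).factorial := by
    rw [← Nat.mul_factorial_pred (by omega : 2 * m ≠ 0)]; push_cast; rfl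
  have h5 : (2 : ℝ) ^ (2 * m) = 2 * 2 ^ (2 * m - 1) := by rw [← pow_succ', h3]
  have h6 : ((2 * m - 1).factorial : ℝ) ≠ 0 := by positivity
  have h7 : (m : ℝ) ≠ 0 := by exact_mod_cast hm
  rw [h4, mul_pow, h5]
  simp [hm]
  field_simp
  ring

/-- For even `k` both sides vanish; for odd `k` this is Euler's formula, the powers of `i` absorbing
the sign. -/
theorem boseMoment_eq {k : ℕ} (hk : k ≠ 0) : (boseMoment k : ℂ) =
    -((2 * π * Complex.I) ^ (k + 1) * (bernoulli (k + 1) : ℚ) / (k + 1)) := by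
  rcases k.even_or_odd with h | h
  · rw [boseMoment, h.neg_one_pow, bernoulli_eq_zero_of_odd h.add_one (by omega)]
    simp
  · obtain ⟨j, rfl⟩ := h
    have h1 := integral_pow_div_exp_sub_one_eq (m := j + 1) (by omega)
    rw [show 2 * (j + 1) - 1 = 2 * j + 1 by omega] at h1
    rw [boseMoment, h1, show 2 * j + 1 + 1 = 2 * (j + 1) by ring, mul_pow _ Complex.I,
      pow_mul Complex.I, Complex.I_sq, Odd.neg_one_pow ⟨j, rfl⟩]
    have : (j : ℂ) + 1 ≠ 0 := by exact_mod_cast j.succ_ne_zero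
    push_cast
    rw [show 2 * (j : ℂ) + 1 + 1 = 2 * (j + 1) by ring]
    field_simp
    ring

end Moments

/-! ### The logarithmic integrals -/

section LogIntegral

open Set MeasureTheory Real

/-- The integrand after the substitution `t = exp s`. -/
noncomputable def expIntegrand (n : ℕ) (z s : ℝ) : ℝ :=
  (s ^ n - z ^ n) * (1 / (1 - rexp (-(s - z))) - 1 / (1 + rexp (-s)))

/-- The two step functions jump at `z` and at `0`, so their difference has bounded support and all
three summands are integrable. -/
theorem expIntegrand_eq (n : ℕ) (z s : ℝ) : expIntegrand n z s =
    (((s - z) + z) ^ n - z ^ n) * boseKernel (s - z) +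
    (s ^ n * fermiKernel s - z ^ n * (s ^ 0 * fermiKernel s)) +
    (s ^ n - z ^ n) * ((if z < s then 1 else 0) - if 0 < s then 1 else 0) := by
  simp only [expIntegrand, boseKernel, fermiKernel, sub_pos, sub_add_cancel]
  ring

theorem integrable_and_integral_translate_pow_mul_boseKernel (n : ℕ) (z : ℝ) :
    Integrable (fun u => ((u + z) ^ n - z ^ n) * boseKernel u) ∧
      ∫ u, ((u + z) ^ n - z ^ n) * boseKernel u =
        ∑ k ∈ Finset.Icc 1 n, n.choose k * z ^ (n - k) * boseMoment k := by
  have e : (fun u => ((u + z) ^ n - z ^ n) * boseKernel u) = fun u =>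
      ∑ k ∈ Finset.Icc 1 n, n.choose k * z ^ (n - k) * (u ^ k * boseKernel u) := by
    ext u
    rw [add_pow, Finset.sum_range_eq_add_Ico _ (by omega), Finset.Ico_add_one_right_eq_Icc]
    simp only [pow_zero, Nat.sub_zero, Nat.choose_zero_right, Nat.cast_one, one_mul, mul_one,
      add_sub_cancel_left, Finset.sum_mul]
    exact Finset.sum_congr rfl fun k _ => by ring
  have hk {k : ℕ} (h : k ∈ Finset.Icc 1 n) : k ≠ 0 := by
    have := (Finset.mem_Icc.1 h).1; omega
  have hi : ∀ k ∈ Finset.Icc 1 n, Integrable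
      (fun u => n.choose k * z ^ (n - k) * (u ^ k * boseKernel u)) :=
    fun k h => (boseKernel_moment (hk h)).1.const_mul _
  rw [e]
  refine ⟨integrable_finsetSum _ hi, ?_⟩
  rw [integral_finsetSum _ hi]
  refine Finset.sum_congr rfl fun k h => ?_
  rw [integral_const_mul, (boseKernel_moment (hk h)).2]

theorem integrable_and_integral_expIntegrand (n : ℕ) (z : ℝ) :
    Integrable (expIntegrand n z) ∧ ∫ s, expIntegrand n z s =
      (∑ k ∈ Finset.Icc 1 n, n.choose k * z ^ (n - k) * boseMoment k) +
      (1 - 1 / 2 ^ n) * boseMoment n + n / (n + 1) * z ^ (n + 1) := by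
  obtain ⟨a1, a2⟩ := integrable_and_integral_translate_pow_mul_boseKernel n z
  have b1 := a1.comp_sub_right z
  have b2 := integral_sub_right_eq_self
    (μ := volume) (fun u => ((u + z) ^ n - z ^ n) * boseKernel u) z
  obtain ⟨c1, c2⟩ := fermiKernel_moment n
  obtain ⟨d1, d2⟩ := fermiKernel_moment 0
  obtain ⟨e1, e2⟩ := integrable_and_integral_mul_step
    (f := fun s : ℝ => s ^ n - z ^ n) (by fun_prop) z 0
  have d3 := d1.const_mul (z ^ n)
  have cd : Integrable (fun s => s ^ n * fermiKernel s - z ^ n * (s ^ 0 * fermiKernel s)) :=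
    c1.sub d3
  have bcd : Integrable (fun s => ((s - z + z) ^ n - z ^ n) * boseKernel (s - z) +
      (s ^ n * fermiKernel s - z ^ n * (s ^ 0 * fermiKernel s))) := b1.add cd
  refine ⟨(bcd.add e1).congr (.of_forall fun s => (expIntegrand_eq n z s).symm), ?_⟩
  simp only [expIntegrand_eq]
  rw [integral_add bcd e1, integral_add b1 cd, integral_sub c1 d3,
    integral_const_mul, b2, a2, c2, d2, e2, intervalIntegral.integral_sub, integral_pow,
    intervalIntegral.integral_const]
  · simp only [pow_zero, smul_eq_mul]
    rw [zero_pow n.succ_ne_zero]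
    field_simp
    ring
  · exact (continuous_pow n).intervalIntegrable _ _
  · exact continuous_const.intervalIntegrable _ _

theorem exp_smul_log_integrand (n : ℕ) (z s : ℝ) :
    |rexp s| • ((Real.log (rexp s) ^ n - z ^ n) / ((1 + rexp s) * (rexp s - rexp z))) =
      (rexp z + 1)⁻¹ * expIntegrand n z s := by
  rw [log_exp, abs_of_pos (exp_pos s), expIntegrand, smul_eq_mul]
  rcases eq_or_ne s z with rfl | h
  · simp
  · have h1 : rexp s - rexp z ≠ 0 := sub_ne_zero.2 fun h' => h (exp_injective h')
    have h2 : 1 + rexp s ≠ 0 := by positivity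
    have h3 : rexp z + 1 ≠ 0 := by positivity
    have h4 : 1 / (1 - rexp (-(s - z))) = rexp s / (rexp s - rexp z) := by
      rw [neg_sub, exp_sub, one_sub_div (exp_ne_zero s), one_div_div]
    have h5 : 1 / (1 + rexp (-s)) = rexp s / (1 + rexp s) := by
      rw [exp_neg]; field_simp; ring
    rw [h4, h5]
    field_simp
    ring

theorem integrableOn_and_integral_log_integrand (n : ℕ) (z : ℝ) :
    IntegrableOn (fun t : ℝ => (Real.log t ^ n - z ^ n) / ((1 + t) * (t - rexp z))) (Ioi 0) ∧
      (rexp z + 1) * ∫ t in Ioi (0 : ℝ),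
        (Real.log t ^ n - z ^ n) / ((1 + t) * (t - rexp z)) = ∫ s, expIntegrand n z s := by
  have hr : Ioi (0 : ℝ) = rexp '' univ := by rw [image_univ, Real.range_exp]
  have hd : ∀ x ∈ (univ : Set ℝ), HasDerivWithinAt rexp (rexp x) univ x :=
    fun x _ => (hasDerivAt_exp x).hasDerivWithinAt
  rw [hr, integrableOn_image_iff_integrableOn_abs_deriv_smul MeasurableSet.univ hd
    exp_injective.injOn, integral_image_eq_integral_abs_deriv_smul MeasurableSet.univ hd
    exp_injective.injOn]
  simp only [exp_smul_log_integrand, integrableOn_univ, setIntegral_univ, integral_const_mul]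
  refine ⟨(integrable_and_integral_expIntegrand n z).1.const_mul _, ?_⟩
  rw [mul_inv_cancel_left₀ (by positivity)]

theorem pi_pow_mul_aeval_quadraticC (n : ℕ) (z : ℝ) :
    π ^ (n + 1) * Polynomial.aeval (z / π) (quadraticC n) =
      (∑ k ∈ Finset.Icc 1 n, n.choose k * z ^ (n - k) * boseMoment k) +
      (1 - 1 / 2 ^ n) * boseMoment n + n / (n + 1) * z ^ (n + 1) := by
  have hn : (n : ℂ) + 1 ≠ 0 := by exact_mod_cast n.succ_ne_zero
  have hπ : (π : ℂ) ≠ 0 := by exact_mod_cast pi_ne_zero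
  have h := quadraticC.closed_form n ((z / π : ℝ) : ℂ)
  have ha : Polynomial.aeval ((z / π : ℝ) : ℂ) (quadraticC n) =
      ((Polynomial.aeval (z / π) (quadraticC n) : ℝ) : ℂ) :=
    Polynomial.aeval_algebraMap_apply ℂ (z / π) (quadraticC n)
  have hlast : ((1 - 1 / 2 ^ n) * boseMoment n : ℂ) = -((2 * π * Complex.I) ^ (n + 1) *
      (1 - 1 / 2 ^ n) * (bernoulli (n + 1) : ℚ) / (n + 1)) := by
    -- `boseMoment_eq` excludes index 0, but there `1 - 1 / 2 ^ n` vanishes.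
    rcases eq_or_ne n 0 with rfl | h0
    · simp
    · rw [boseMoment_eq h0]; ring
  apply Complex.ofReal_injective
  apply mul_left_cancel₀ hn
  rw [ha] at h
  push_cast at h ⊢
  rw [mul_left_comm, h, hlast, mul_add, mul_add, mul_sub, mul_sub, Finset.mul_sum, Finset.mul_sum,
    div_pow]
  have hsum : ∑ k ∈ Finset.Icc 1 n, (π : ℂ) ^ (n + 1) * (((n + 1).choose (k + 1) : ℂ) *
      (2 * Complex.I) ^ (k + 1) * (bernoulli (k + 1) : ℚ) * (z / π) ^ (n - k)) =
      -∑ k ∈ Finset.Icc 1 n, ((n : ℂ) + 1) * (n.choose k * z ^ (n - k) * boseMoment k) := by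
    rw [← Finset.sum_neg_distrib]
    refine Finset.sum_congr rfl fun k hk => ?_
    obtain ⟨hk1, hk2⟩ := Finset.mem_Icc.1 hk
    have hk3 : (k : ℂ) + 1 ≠ 0 := by exact_mod_cast k.succ_ne_zero
    have hc : ((n + 1).choose (k + 1) : ℂ) = (n + 1) * n.choose k / (k + 1) :=
      eq_div_of_mul_eq hk3 (by exact_mod_cast (Nat.add_one_mul_choose_eq n k).symm)
    rw [boseMoment_eq (by omega), div_pow, show n + 1 = (n - k) + (k + 1) by omega,
      pow_add (π : ℂ), show n - k + (k + 1) = n + 1 by omega, hc, mul_pow, mul_pow, mul_pow]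
    field_simp
  rw [hsum]
  simp only [mul_pow]
  field_simp
  ring

theorem image_exp_neg_Ioi_zero : (fun u : ℝ => rexp (-u)) '' Ioi 0 = Ioo 0 1 := by
  ext x
  constructor
  · rintro ⟨u, hu, rfl⟩
    exact ⟨exp_pos _, Real.exp_lt_one_iff.2 (neg_lt_zero.2 hu)⟩
  · rintro ⟨h0, h1⟩
    exact ⟨-Real.log x, neg_pos.2 (Real.log_neg h0 h1), by simp [Real.exp_log h0]⟩

/-- Partial fractions for `e^u / (e^{2u} - 1)`; oddness of `k` cancels the sign of `x² - 1`. -/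
theorem exp_neg_smul_log_pow_div {k : ℕ} (hk : Odd k) {u : ℝ} (hu : 0 < u) :
    |-rexp (-u)| • (Real.log (rexp (-u)) ^ k / (rexp (-u) ^ 2 - 1)) =
      1 / 2 * (u ^ k / (rexp u - 1) + u ^ k / (rexp u + 1)) := by
  have h1 : rexp u - 1 ≠ 0 := (sub_pos.2 (one_lt_exp_iff.2 hu)).ne'
  have h2 : rexp u + 1 ≠ 0 := by positivity
  have h3 : rexp (-u) ^ 2 - 1 = -((rexp u - 1) * (rexp u + 1)) / rexp u ^ 2 := by
    rw [exp_neg]; field_simp; ring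
  rw [log_exp, hk.neg_pow, abs_neg, abs_of_pos (exp_pos _), smul_eq_mul, h3, exp_neg]
  field_simp
  ring

theorem integrableOn_and_integral_log_pow_div {k : ℕ} (hk : Odd k) :
    IntegrableOn (fun x : ℝ => Real.log x ^ k / (x ^ 2 - 1)) (Ioo 0 1) ∧
      ∫ x in Ioo (0 : ℝ) 1, Real.log x ^ k / (x ^ 2 - 1) =
        (1 - 1 / 2 ^ (k + 1)) * ∫ x in Ioi (0 : ℝ), x ^ k / (rexp x - 1) := by
  have hd : ∀ x ∈ Ioi (0 : ℝ), HasDerivWithinAt (fun u => rexp (-u)) (-rexp (-x)) (Ioi 0) x :=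
    fun x _ => by simpa using (hasDerivAt_neg x).exp.hasDerivWithinAt
  have hinj : InjOn (fun u : ℝ => rexp (-u)) (Ioi 0) :=
    fun x _ y _ h => neg_injective (exp_injective h)
  have hk0 : k ≠ 0 := hk.pos.ne'
  have i1 := integrableOn_pow_div_exp_sub_one hk0
  have i2 := integrableOn_pow_div_exp_add_one k
  have e : EqOn (fun u => 1 / 2 * (u ^ k / (rexp u - 1) + u ^ k / (rexp u + 1)))
      (fun u => |-rexp (-u)| • (Real.log (rexp (-u)) ^ k / (rexp (-u) ^ 2 - 1))) (Ioi 0) :=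
    fun u hu => (exp_neg_smul_log_pow_div hk hu).symm
  rw [← image_exp_neg_Ioi_zero, integrableOn_image_iff_integrableOn_abs_deriv_smul
    measurableSet_Ioi hd hinj, integral_image_eq_integral_abs_deriv_smul measurableSet_Ioi hd hinj]
  refine ⟨IntegrableOn.congr_fun ((i1.add i2).const_mul _) e measurableSet_Ioi, ?_⟩
  rw [← setIntegral_congr_fun measurableSet_Ioi e, integral_const_mul, integral_add i1 i2,
    integral_pow_div_exp_add_one hk0]
  ring

end LogIntegral

theorem mainTheorem6 :
    (∀ (n : ℕ) (z : ℝ),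
      MeasureTheory.IntegrableOn
        (fun t : ℝ => (Real.log t ^ n - z ^ n) / ((1 + t) * (t - Real.exp z))) (Set.Ioi 0) ∧
      (Real.exp z + 1) *
          ∫ t in Set.Ioi (0 : ℝ), (Real.log t ^ n - z ^ n) / ((1 + t) * (t - Real.exp z)) =
        Real.pi ^ (n + 1) * Polynomial.aeval (z / Real.pi) (quadraticC n)) ∧
    (∀ n : ℕ, 1 ≤ n →
      MeasureTheory.IntegrableOn
        (fun x : ℝ => Real.log x ^ (2 * n - 1) / (x ^ 2 - 1)) (Set.Ioo 0 1) ∧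
      4 * ∫ x in Set.Ioo (0 : ℝ) 1, Real.log x ^ (2 * n - 1) / (x ^ 2 - 1) =
        (4 ^ n - 1) * (-1) ^ (n - 1) * (bernoulli (2 * n) : ℝ) / (n : ℝ) *
          Real.pi ^ (2 * n)) := by
  refine ⟨fun n z => ?_, fun n hn => ?_⟩
  · obtain ⟨h1, h2⟩ := integrableOn_and_integral_log_integrand n z
    exact ⟨h1, by rw [h2, (integrable_and_integral_expIntegrand n z).2,
      pi_pow_mul_aeval_quadraticC]⟩
  · obtain ⟨h1, h2⟩ := integrableOn_and_integral_log_pow_div (k := 2 * n - 1) ⟨n - 1, by omega⟩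
    refine ⟨h1, ?_⟩
    have hn0 : (n : ℝ) ≠ 0 := by positivity
    -- The factor `4 ^ n - 1` is `1 - 1 / 4 ^ n` times the `2 ^ (2n)` in `(2π) ^ (2n)`.
    rw [h2, integral_pow_div_exp_sub_one_eq (by omega), show 2 * n - 1 + 1 = 2 * n by omega,
      mul_pow, pow_mul 2 2 n, show n + 1 = n - 1 + 2 by omega, pow_add (-1 : ℝ) (n - 1) 2]
    norm_num
    field_simp
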